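/- Let $(\sigma_1,\sigma_2,\sigma_3)=(X,Y,Z)$ be the Pauli matrices and, for $a\in\{0,1\}$, $x\in\{1,2,3\}$, $y\in\{0,1\}$, put $$\sigma_{a|xy}=\tfrac14\bigl(\mathbb I+(-1)^{a+\delta_{x,2}\delta_{y,1}}\sigma_x\bigr).$$ Then the following hold. 1. $\{\sigma_{a|xy}\}$ is a non-signalling Bob-with-input assemblage: $\sigma_{a|xy}\ge 0$, $\sum_a\sigma_{a|xy}$ does not depend on $x$, $\operatorname{tr}\sigma_{a|xy}$ is a real number that does not depend on $y$, and $\operatorname{tr}\sum_a\sigma_{a|xy}=1$. 2. $\sigma_{a|xy}=\mathcal T_y\bigl[\operatorname{tr}_A\{(P_{a|x}\otimes\mathbb I)|\Phi\rangle\langle\Phi|\}\bigr]$, where $|\Phi\rangle=(|00\rangle+|11\rangle)/\sqrt2$ is maximally entangled, $P_{a|x}=\frac12(\mathbb I+(-1)^{a+\delta_{x,2}}\sigma_x)$ is the measurement of $\sigma_x$ (with the two outcome labels of $Y$ interchanged), $\mathcal T_0$ is the identity and $\mathcal T_1$ is the transpose. 3. $\{\sigma_{a|xy}\}$ has no quantum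 realisation: there are no Hilbert space $\mathcal H_A$ (of any dimension), finite-dimensional $\mathcal H_B$, POVMs $\{M_{a|x}\}_a$ on $\mathcal H_A$, density operator $\rho$ on $\mathcal H_A\otimes\mathcal H_B$ and completely positive trace-preserving maps $\mathcal E_y$ from operators on $\mathcal H_B$ to operators on $\mathbb C^2$ such that $\sigma_{a|xy}=\mathcal E_y\bigl[\operatorname{tr}_A\{(M_{a|x}\otimes\mathbb I)\rho\}\bigr]$ for all $a,x,y$. 4. For every POVM $\{N_b\}_b$ on $\mathbb C^2$ with finitely many outcomes, $p(ab|xy)=\operatorname{tr}\{N_b\,\sigma_{a|xy}\}$ are quantum Bell correlations: there are finite-dimensional Hilbert spaces $\mathcal H_A,\mathcal H_B$, POVMs $\{M_{a|x}\}_a$ on $\mathcal H_A$ and $\{M'_{b|y}\}_b$ on $\mathcal H_B$, and a density operator $\rho$ on $\mathcal H_A\otimes\mathcal H_B$ with $p(ab|xy)=\operatorname{tr}\{(M_{a|x}\otimes M'_{b|y})\rho\}$. More generally, for every family of such POVMs $\{N_{b|z}\}_b$, $p(ab|xyz)=\operatorname{tr}\{N_{b|z}\,\sigma_{a|xy}\}$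 are quantum Bell correlations, $(y,z)$ being Bob's input. In particular, post-quantum steering in the Bob-with-input scenario does not imply post-quantum nonlocality. -/

import Mathlib

open scoped TensorProduct Kronecker ComplexOrder

universe u v w

noncomputable section

namespace Steering

/-! ### Matrices: measurements, states, channels -/

/-- A POVM with finitely many outcomes on `ℂ^d`. -/
def IsPOVM {B d : Type*} [Fintype B] [Fintype d] [DecidableEq d] (N : B → Matrix d d ℂ) : Prop :=
  (∀ b, (N b).PosSemidef) ∧ ∑ b, N b = 1

/-- A density matrix. -/
def IsDensityMatrix {d : Type*} [Fintype d] (ρ : Matrix d d ℂ) : Prop :=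
  ρ.PosSemidef ∧ ρ.trace = 1

/-- `id_k ⊗ E` applied to a matrix on `ℂ^k ⊗ ℂ^d`: the map `E` is applied to each of the
`k × k` blocks, which are `d × d` matrices. -/
def ampliation {d d' : Type*} (k : ℕ) (E : Matrix d d ℂ →ₗ[ℂ] Matrix d' d' ℂ)
    (P : Matrix (Fin k × d) (Fin k × d) ℂ) : Matrix (Fin k × d') (Fin k × d') ℂ :=
  Matrix.of fun r s => E (Matrix.of fun p q => P (r.1, p) (s.1, q)) r.2 s.2

/-- Completely positive and trace-preserving maps. -/
def IsCPTP {d d' : Type*} [Fintype d] [Fintype d']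
    (E : Matrix d d ℂ →ₗ[ℂ] Matrix d' d' ℂ) : Prop :=
  (∀ (k : ℕ) (P : Matrix (Fin k × d) (Fin k × d) ℂ), P.PosSemidef → (ampliation k E P).PosSemidef) ∧
    ∀ P, (E P).trace = P.trace

/-- Partial trace over the first factor of `ℂ^c ⊗ ℂ^d`. -/
def traceFst {c d : Type*} [Fintype c] (P : Matrix (c × d) (c × d) ℂ) : Matrix d d ℂ :=
  Matrix.of fun i j => ∑ k, P (k, i) (k, j)

/-! ### Operators on `H ⊗ ℂ^n`, for an arbitrary Hilbert space `H` -/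

section Operators

variable {H : Type*} [NormedAddCommGroup H] [InnerProductSpace ℂ H]

/-- A POVM with finitely many outcomes on a Hilbert space `H`. -/
def IsOperatorPOVM {A : Type*} [Fintype A] (M : A → H →L[ℂ] H) : Prop :=
  (∀ a, (M a).IsPositive) ∧ ∑ a, M a = 1

/-- The space `H ⊗ ℂ^n`; as the second factor is finite-dimensional, the algebraic tensor product
with its inner product is already the tensor product of Hilbert spaces. -/
abbrev Joint (H : Type*) [NormedAddCommGroup H] [InnerProductSpace ℂ H] (n : ℕ) : Type _ :=
  H ⊗[ℂ] EuclideanSpace ℂ (Fin n)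

/-- The vector `e_k ⊗ |i⟩`, for an orthonormal basis `e` of `H`. -/
def jointBasis {ι : Type*} {n : ℕ} (e : HilbertBasis ι ℂ H) (k : ι) (i : Fin n) : Joint H n :=
  e k ⊗ₜ[ℂ] EuclideanSpace.single i (1 : ℂ)

/-- Density operators on `H ⊗ ℂ^n`: positive bounded operators of trace one. The trace is computed
in the orthonormal basis `e_k ⊗ |i⟩`; for positive operators it does not depend on the basis. -/
def IsDensityOperator {ι : Type*} {n : ℕ} (e : HilbertBasis ι ℂ H)
    (ρ : Joint H n →L[ℂ] Joint H n) : Prop :=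
  ρ.IsPositive ∧
    HasSum (fun k : ι × Fin n => inner ℂ (jointBasis e k.1 k.2) (ρ (jointBasis e k.1 k.2))) 1

/-- `τ = tr_H T`, with matrix entries `⟨i|τ|j⟩ = ∑_k ⟨e_k ⊗ i, T (e_k ⊗ j)⟩`. -/
def IsPartialTrace {ι : Type*} {n : ℕ} (e : HilbertBasis ι ℂ H)
    (T : Joint H n →ₗ[ℂ] Joint H n) (τ : Matrix (Fin n) (Fin n) ℂ) : Prop :=
  ∀ i j, HasSum (fun k : ι => inner ℂ (jointBasis e k i) (T (jointBasis e k j))) (τ i j)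

end Operators

/-! ### Bob-with-input assemblages

`σ a x y` stands for `σ_{a|xy}`. -/

/-- Non-signalling Bob-with-input assemblages. -/
def IsNonSignalling {A X Y d : Type} [Fintype A] [Fintype d]
    (σ : A → X → Y → Matrix d d ℂ) : Prop :=
  (∀ a x y, (σ a x y).PosSemidef) ∧
  (∀ x x' y, ∑ a, σ a x y = ∑ a, σ a x' y) ∧
  (∃ p : A → X → ℝ, ∀ a x y, (σ a x y).trace = (p a x : ℂ)) ∧
  ∀ x y, (∑ a, σ a x y).trace = 1

/-- Quantum Bob-with-input assemblages: there are a Hilbert space `H` and POVMs `M_{·|x}` on it for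
Alice, a state `ρ` on `H ⊗ ℂ^n`, and CPTP maps `E_y` for Bob such that
`σ_{a|xy} = E_y [tr_H ((M_{a|x} ⊗ 1) ρ)]`. The system of dimension `n` on which Bob's maps act may
differ from their output system, on which the assemblage lives. -/
def IsQuantumRealisable {A X Y d : Type} [Fintype A] [Fintype d]
    (σ : A → X → Y → Matrix d d ℂ) : Prop :=
  ∃ (H : Type u) (_ : NormedAddCommGroup H) (_ : InnerProductSpace ℂ H) (_ : CompleteSpace H)
    (ι : Type u) (e : HilbertBasis ι ℂ H) (n : ℕ)
    (M : A → X → H →L[ℂ] H) (ρ : Joint H n →L[ℂ] Joint H n)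
    (τ : A → X → Matrix (Fin n) (Fin n) ℂ)
    (E : Y → Matrix (Fin n) (Fin n) ℂ →ₗ[ℂ] Matrix d d ℂ),
    (∀ x, IsOperatorPOVM (fun a => M a x)) ∧
    IsDensityOperator e ρ ∧
    (∀ a x, IsPartialTrace e
      ((M a x).toLinearMap.rTensor (EuclideanSpace ℂ (Fin n)) ∘ₗ ρ.toLinearMap) (τ a x)) ∧
    (∀ y, IsCPTP (E y)) ∧
    ∀ a x y, σ a x y = E y (τ a x)

/-! ### Bell correlations -/

/-- Quantum Bell correlations `p(ab|xy) = tr ((M_{a|x} ⊗ N_{b|y}) ρ)`, with finite-dimensional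
local systems; `p a b x y` stands for `p(ab|xy)`. -/
def IsQuantumBell {A B X Y : Type*} [Fintype A] [Fintype B] (p : A → B → X → Y → ℂ) : Prop :=
  ∃ (m n : ℕ) (M : A → X → Matrix (Fin m) (Fin m) ℂ) (N : B → Y → Matrix (Fin n) (Fin n) ℂ)
    (ρ : Matrix (Fin m × Fin n) (Fin m × Fin n) ℂ),
    (∀ x, IsPOVM (fun a => M a x)) ∧ (∀ y, IsPOVM (fun b => N b y)) ∧ IsDensityMatrix ρ ∧
    ∀ a b x y, p a b x y = ((M a x ⊗ₖ N b y) * ρ).trace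

/-! ### The example -/

/-- The Pauli matrices `X, Y, Z`; the labels `1, 2, 3` are `0, 1, 2` here. -/
def pauli : Fin 3 → Matrix (Fin 2) (Fin 2) ℂ :=
  ![!![0, 1; 1, 0], !![0, -Complex.I; Complex.I, 0], !![1, 0; 0, -1]]

/-- The exponent `δ_{x,2}`: one for the Pauli matrix `Y`, zero for `X` and `Z`. -/
def deltaY (x : Fin 3) : ℕ := if x = 1 then 1 else 0

/-- `σ_{a|xy} = (1 + (-1)^{a + δ_{x,2} δ_{y,1}} σ_x) / 4`. -/
def exampleAssemblage (a : Fin 2) (x : Fin 3) (y : Fin 2) : Matrix (Fin 2) (Fin 2) ℂ :=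
  (1 / 4 : ℂ) • (1 + (-1 : ℂ) ^ ((a : ℕ) + deltaY x * (if y = 1 then 1 else 0)) • pauli x)

/-- The measurement of the Pauli observable `σ_x`, with the two outcomes of `Y` labelled in the
opposite order: the projections `(1 + (-1)^{a + δ_{x,2}} σ_x) / 2`. -/
def pauliMeasurement (a : Fin 2) (x : Fin 3) : Matrix (Fin 2) (Fin 2) ℂ :=
  (1 / 2 : ℂ) • (1 + (-1 : ℂ) ^ ((a : ℕ) + deltaY x) • pauli x)

/-- The maximally entangled vector `(|00⟩ + |11⟩) / √2`. -/
def phiPlus : Fin 2 × Fin 2 → ℂ := fun p => if p.1 = p.2 then ((√2 : ℝ) : ℂ)⁻¹ else 0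

/-- The projection onto the maximally entangled vector. -/
def maxEntangled : Matrix (Fin 2 × Fin 2) (Fin 2 × Fin 2) ℂ :=
  Matrix.vecMulVec phiPlus (star phiPlus)

/-- The identity for `y = 0` and the transpose for `y = 1`. -/
def bobMap (y : Fin 2) (P : Matrix (Fin 2) (Fin 2) ℂ) : Matrix (Fin 2) (Fin 2) ℂ :=
  if y = 0 then P else P.transpose

end Steering

end

/-! No realisation exists because the transpose reverses products of Pauli matrices, while Alice's
data do not depend on `y`. Suppose that `τ a x` are the steered states and put `D x = τ 0 x - τ 1
x`, `T = τ 0 x + τ 1 x`; since Alice's effects sum to one, `T` is the same for all `x`. Each `E y (τ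
a x)` is a multiple of an eigenprojection of a Pauli matrix, so every Kraus operator `K i` of `E y`
satisfies `K i * D x = ±pauli x * (K i * T)`, the sign being negative only for `Y` at `y = 1`.
Inserting `∑ i, (K i)ᴴ * K i = 1` between two factors turns this into relations without `K`
(`pauli_relations_of_cptp`): `D 0 * D 2 = ∓i T * D 1` and `D 1 * D 1 = T * T`. The left side of the
first does not see `y`, the sign does; hence `T * D 1 = 0`, so `T ^ 4 = 0` and the Hermitian `T`
vanishes, against trace one.

In infinite dimension the analytic input is that the steered matrices are positive
(`IsPartialTrace.posSemidef`), which rests on cyclicity of the trace.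

The Bell correlations are quantum because the transpose, though not completely positive, still sends
POVMs to POVMs, and can be moved onto Bob's measurement. -/

namespace Steering

/-! ### Partial traces over an arbitrary Hilbert space -/

noncomputable section Hilbert

variable {H ι : Type*} [NormedAddCommGroup H] [InnerProductSpace ℂ H]

theorem hasSum_norm_inner_sq (e : HilbertBasis ι ℂ H) (x : H) :
    HasSum (fun k => ‖inner ℂ (e k) x‖ ^ 2) (‖x‖ ^ 2) := by
  have h := e.hasSum_inner_mul_inner x x
  have h2 := Complex.hasSum_re h
  convert h2 using 1
  · funext k
    rw [← inner_conj_symm x (e k), ← Complex.normSq_eq_conj_mul_self, Complex.normSq_eq_norm_sq,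
      Complex.ofReal_re]
  · exact (inner_self_eq_norm_sq (𝕜 := ℂ) x).symm

/-- A family of vectors with square-summable norms has a square-summable matrix. -/
theorem summable_norm_inner_sq (e : HilbertBasis ι ℂ H) {x : ι → H}
    (hx : Summable fun k => ‖x k‖ ^ 2) :
    Summable fun p : ι × ι => ‖inner ℂ (e p.2) (x p.1)‖ ^ 2 := by
  rw [summable_prod_of_nonneg (fun p => by positivity)]
  refine ⟨fun k => (hasSum_norm_inner_sq e (x k)).summable, ?_⟩
  convert hx using 2 with k
  exact (hasSum_norm_inner_sq e (x k)).tsum_eq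

/-- The trace of a product of two positive operators, one of which is of trace class, is
nonnegative. -/
theorem nonneg_of_hasSum_inner_mul [CompleteSpace H] (e : HilbertBasis ι ℂ H) {M P : H →L[ℂ] H}
    (hM : M.IsPositive) (hP : P.IsPositive) (hs : Summable fun k => inner ℂ (e k) (P (e k)))
    {t : ℂ} (ht : HasSum (fun k => inner ℂ (e k) (M (P (e k)))) t) : 0 ≤ t := by
  obtain ⟨R, hR, hRR⟩ : ∃ R : H →L[ℂ] H, R.IsPositive ∧ R * R = P :=
    ⟨CFC.sqrt P, (ContinuousLinearMap.nonneg_iff_isPositive _).1 (CFC.sqrt_nonneg P),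
      CFC.sqrt_mul_sqrt_self P ((ContinuousLinearMap.nonneg_iff_isPositive _).2 hP)⟩
  have hPR : ∀ x, P x = R (R x) := fun x => by rw [← hRR]; rfl
  have hsR : Summable fun k => ‖R (e k)‖ ^ 2 := by
    convert (Complex.hasSum_re hs.hasSum).summable using 2 with k
    rw [hPR, ← hR.inner_left_eq_inner_right]
    exact (inner_self_eq_norm_sq (𝕜 := ℂ) _).symm
  have hsMR : Summable fun k => ‖M (R (e k))‖ ^ 2 := by
    refine Summable.of_nonneg_of_le (fun k => by positivity) (fun k => ?_) (hsR.mul_left (‖M‖ ^ 2))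
    rw [← mul_pow]
    gcongr
    exact M.le_opNorm _
  -- With `P = R * R`, both factors are matrix entries of Hilbert–Schmidt operators, so the double
  -- series converges absolutely. Its two iterated sums are the traces of `M R R` and of `R M R`;
  -- the latter is visibly nonnegative.
  have hf : Summable fun p : ι × ι =>
      inner ℂ (e p.1) (M (R (e p.2))) * inner ℂ (e p.2) (R (e p.1)) := by
    have h1 := (summable_norm_inner_sq e hsMR).prod_symm
    have h2 := summable_norm_inner_sq e hsR
    refine Summable.of_norm_bounded (h1.add h2) fun p => ?_
    rw [norm_mul]
    simp only [Prod.swap]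
    nlinarith [sq_nonneg (‖inner ℂ (e p.1) (M (R (e p.2)))‖ - ‖inner ℂ (e p.2) (R (e p.1))‖),
      sq_nonneg (‖inner ℂ (e p.1) (M (R (e p.2)))‖), sq_nonneg ‖inner ℂ (e p.2) (R (e p.1))‖]
  obtain ⟨s, hs'⟩ := hf
  have h1 : HasSum (fun k => inner ℂ (e k) (M (P (e k)))) s := by
    refine hs'.prod_fiberwise fun k => ?_
    have := e.hasSum_inner_mul_inner (R (M (e k))) (R (e k))
    rw [hPR]
    simpa only [hR.inner_left_eq_inner_right, hM.inner_left_eq_inner_right] using this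
  have h2 : HasSum (fun l => inner ℂ (R (e l)) (M (R (e l)))) s := by
    refine ((Equiv.prodComm ι ι).hasSum_iff.2 hs').prod_fiberwise fun l => ?_
    have := e.hasSum_inner_mul_inner (R (e l)) (M (R (e l)))
    simp only [Function.comp, Equiv.prodComm_apply, Prod.swap]
    simpa only [hR.inner_left_eq_inner_right, mul_comm] using this
  rw [ht.unique h1]
  exact h2.nonneg fun l => hM.inner_nonneg_right _

variable {n : ℕ}

/-- The contraction `h ⊗ w ↦ ⟨v, w⟩ h`, adjoint to `h ↦ h ⊗ v`. -/
def contractRight (H : Type*) [NormedAddCommGroup H] [InnerProductSpace ℂ H] {n : ℕ}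
    (v : EuclideanSpace ℂ (Fin n)) : Joint H n →ₗ[ℂ] H :=
  (TensorProduct.rid ℂ H).toLinearMap ∘ₗ (innerSL ℂ v).toLinearMap.lTensor H

theorem contractRight_tmul (v w : EuclideanSpace ℂ (Fin n)) (h : H) :
    contractRight H v (h ⊗ₜ w) = inner ℂ v w • h := by
  simp [contractRight]

theorem inner_contractRight (v : EuclideanSpace ℂ (Fin n)) (h : H) (t : Joint H n) :
    inner ℂ h (contractRight H v t) = inner ℂ (h ⊗ₜ[ℂ] v) t := by
  induction t using TensorProduct.induction_on with
  | zero => simp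
  | tmul g w => rw [contractRight_tmul, inner_smul_right, TensorProduct.inner_tmul, mul_comm]
  | add a b ha hb => rw [map_add, inner_add_right, inner_add_right, ha, hb]

theorem contractRight_rTensor (v : EuclideanSpace ℂ (Fin n)) (M : H →ₗ[ℂ] H) (t : Joint H n) :
    contractRight H v (M.rTensor _ t) = M (contractRight H v t) := by
  induction t using TensorProduct.induction_on with
  | zero => simp
  | tmul g w => rw [LinearMap.rTensor_tmul, contractRight_tmul, contractRight_tmul, map_smul]
  | add a b ha hb => simp only [map_add, ha, hb]

/-- The operator `⟨v| ρ |v⟩` on `H`. -/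
def compression (ρ : Joint H n →L[ℂ] Joint H n) (v : EuclideanSpace ℂ (Fin n)) : H →ₗ[ℂ] H :=
  contractRight H v ∘ₗ ρ.toLinearMap ∘ₗ (TensorProduct.mk ℂ H (EuclideanSpace ℂ (Fin n))).flip v

theorem inner_compression (ρ : Joint H n →L[ℂ] Joint H n) (v : EuclideanSpace ℂ (Fin n))
    (g h : H) : inner ℂ g (compression ρ v h) = inner ℂ (g ⊗ₜ[ℂ] v) (ρ (h ⊗ₜ[ℂ] v)) := by
  simp [compression, inner_contractRight]

theorem isPositive_compression {ρ : Joint H n →L[ℂ] Joint H n} (hρ : ρ.IsPositive)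
    (v : EuclideanSpace ℂ (Fin n)) : (compression ρ v).IsPositive := by
  refine ⟨fun g h => ?_, fun h => ?_⟩
  · rw [inner_compression, ← inner_conj_symm, inner_compression]
    exact (inner_conj_symm _ _).trans (hρ.inner_left_eq_inner_right _ _)
  · rw [inner_re_symm, inner_compression]
    exact hρ.re_inner_nonneg_right _

/-- A partial trace determines the quadratic form of the reduced matrix. -/
theorem IsPartialTrace.hasSum_quadratic {e : HilbertBasis ι ℂ H} {T : Joint H n →ₗ[ℂ] Joint H n}
    {τ : Matrix (Fin n) (Fin n) ℂ} (h : IsPartialTrace e T τ) (v : EuclideanSpace ℂ (Fin n)) :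
    HasSum (fun k => inner ℂ (e k ⊗ₜ[ℂ] v) (T (e k ⊗ₜ[ℂ] v)))
      (star v.ofLp ⬝ᵥ τ.mulVec v.ofLp) := by
  have hv : v = ∑ i, v i • EuclideanSpace.single i (1 : ℂ) := by
    ext j
    simp [Finset.sum_apply, Pi.single_apply]
  have hsum : HasSum (fun k => ∑ i, ∑ j, star (v i) * v j *
      inner ℂ (jointBasis e k i) (T (jointBasis e k j)))
      (∑ i, ∑ j, star (v i) * v j * τ i j) :=
    hasSum_sum fun i _ => hasSum_sum fun j _ => (h i j).mul_left _
  convert hsum using 1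
  · funext k
    have hk : e k ⊗ₜ[ℂ] v = ∑ i, v i • jointBasis e k i := by
      conv_lhs => rw [hv]
      rw [TensorProduct.tmul_sum]
      simp only [TensorProduct.tmul_smul, jointBasis]
    rw [hk, map_sum, sum_inner]
    refine Finset.sum_congr rfl fun i _ => ?_
    rw [inner_sum]
    refine Finset.sum_congr rfl fun j _ => ?_
    rw [map_smul, mul_assoc]
    exact (inner_smul_left (𝕜 := ℂ) (E := Joint H n) _ _ _).trans
      (congrArg _ (inner_smul_right (𝕜 := ℂ) (E := Joint H n) _ _ _))
  · simp only [dotProduct, Matrix.mulVec, Finset.mul_sum, Pi.star_apply]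
    refine Finset.sum_congr rfl fun i _ => Finset.sum_congr rfl fun j _ => by ring

theorem posSemidef_of_quadratic_nonneg {τ : Matrix (Fin n) (Fin n) ℂ}
    (h : ∀ v : EuclideanSpace ℂ (Fin n), 0 ≤ star v.ofLp ⬝ᵥ τ.mulVec v.ofLp) :
    τ.PosSemidef := by
  rw [← Matrix.isPositive_toEuclideanLin_iff, LinearMap.isPositive_iff_complex]
  intro v
  have h1 : (0 : ℂ) ≤ inner ℂ v (τ.toEuclideanLin v) := by
    convert h v using 1
    simp [EuclideanSpace.inner_eq_star_dotProduct, dotProduct_comm]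
  rw [← inner_conj_symm, starRingEnd_apply, (IsSelfAdjoint.of_nonneg h1).star_eq]
  have h2 := Complex.nonneg_iff.1 h1
  exact ⟨Complex.ext rfl h2.2, h2.1⟩

/-- The state to which a measurement outcome steers is positive. -/
theorem IsPartialTrace.posSemidef [CompleteSpace H] {e : HilbertBasis ι ℂ H} {M : H →L[ℂ] H}
    {ρ : Joint H n →L[ℂ] Joint H n} {τ τ' : Matrix (Fin n) (Fin n) ℂ}
    (hM : M.IsPositive) (hρ : ρ.IsPositive) (hτ' : IsPartialTrace e ρ.toLinearMap τ')
    (hτ : IsPartialTrace e (M.toLinearMap.rTensor (EuclideanSpace ℂ (Fin n)) ∘ₗ ρ.toLinearMap) τ) :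
    τ.PosSemidef := by
  refine posSemidef_of_quadratic_nonneg fun v => ?_
  have hpos := isPositive_compression hρ v
  -- Boundedness is Hellinger–Toeplitz: a symmetric operator defined on all of a Hilbert space is
  -- continuous.
  let P : H →L[ℂ] H := ⟨compression ρ v, hpos.isSymmetric.continuous⟩
  refine nonneg_of_hasSum_inner_mul e (P := P) hM hpos ?_ ?_
  · convert (hτ'.hasSum_quadratic v).summable using 2 with k
    exact inner_compression ρ v _ _
  · convert hτ.hasSum_quadratic v using 2 with k
    rw [← inner_contractRight, LinearMap.comp_apply, contractRight_rTensor]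
    rfl

/-- No-signalling from Alice to Bob: with `IsPartialTrace.unique` it makes `∑ a, τ a x` independent
of `x`. -/
theorem IsPartialTrace.sum_of_povm {A : Type*} [Fintype A] {e : HilbertBasis ι ℂ H}
    {M : A → H →L[ℂ] H} {ρ : Joint H n →L[ℂ] Joint H n} {τ : A → Matrix (Fin n) (Fin n) ℂ}
    (hM : ∑ a, M a = 1) (hτ : ∀ a, IsPartialTrace e
      ((M a).toLinearMap.rTensor (EuclideanSpace ℂ (Fin n)) ∘ₗ ρ.toLinearMap) (τ a)) :
    IsPartialTrace e ρ.toLinearMap (∑ a, τ a) := by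
  intro i j
  rw [Matrix.sum_apply]
  convert hasSum_sum (s := Finset.univ) fun a _ => hτ a i j using 2 with k
  refine Eq.trans ?_ (inner_sum (𝕜 := ℂ) Finset.univ
    (fun a => ((M a).toLinearMap.rTensor (EuclideanSpace ℂ (Fin n)) ∘ₗ ρ.toLinearMap)
      (jointBasis e k j)) (jointBasis e k i))
  have h : ∑ a, (M a).toLinearMap = LinearMap.id := by
    ext x
    simpa using congrArg (fun T : H →L[ℂ] H => T x) hM
  have h2 : ∑ a, (M a).toLinearMap.rTensor (EuclideanSpace ℂ (Fin n)) = LinearMap.id := by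
    rw [← LinearMap.rTensor_id, ← h]
    exact (map_sum (LinearMap.rTensorHom (EuclideanSpace ℂ (Fin n)))
      (fun a => (M a).toLinearMap) Finset.univ).symm
  congr 1
  simp only [LinearMap.comp_apply]
  rw [← LinearMap.sum_apply, h2, LinearMap.id_apply]

theorem IsPartialTrace.unique {e : HilbertBasis ι ℂ H} {T : Joint H n →ₗ[ℂ] Joint H n}
    {τ τ' : Matrix (Fin n) (Fin n) ℂ} (h : IsPartialTrace e T τ) (h' : IsPartialTrace e T τ') :
    τ = τ' := by
  ext i j
  exact (h i j).unique (h' i j)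

end Hilbert

open Matrix

/-! ### Kraus operators and intertwining relations -/

section Kraus

/-- Kraus decomposition of a completely positive trace-preserving map. -/
theorem IsCPTP.exists_kraus {n : ℕ} {d : Type*} [Fintype d]
    {E : Matrix (Fin n) (Fin n) ℂ →ₗ[ℂ] Matrix d d ℂ} (hE : IsCPTP E) :
    ∃ (m : ℕ) (K : Fin m → Matrix d (Fin n) ℂ),
      (∀ P, E P = ∑ i, K i * P * (K i)ᴴ) ∧ ∑ i, (K i)ᴴ * K i = 1 := by
  -- The unnormalised maximally entangled vector. Its image under the ampliation is the Choi matrix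
  -- of `E`, whose rank-one summands, reshaped, are the Kraus operators.
  let ω : Fin n × Fin n → ℂ := fun p => if p.1 = p.2 then 1 else 0
  obtain ⟨m, v, hv⟩ := posSemidef_iff_eq_sum_vecMulVec.1
    (hE.1 n _ (posSemidef_vecMulVec_self_star ω))
  have hblock : ∀ k l : Fin n,
      (of fun p q => vecMulVec ω (star ω) (k, p) (l, q)) = single k l (1 : ℂ) := by
    intro k l
    ext p q
    by_cases hk : k = p <;> by_cases hl : l = q <;>
      simp [ω, vecMulVec_apply, hk, hl]
  have hentry : ∀ k l r s, E (single k l 1) r s = ∑ i, v i (k, r) * star (v i (l, s)) := by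
    intro k l r s
    have h := congrFun (congrFun hv (k, r)) (l, s)
    simp only [ampliation, of_apply, hblock] at h
    rw [h, Matrix.sum_apply]
    rfl
  let K : Fin m → Matrix d (Fin n) ℂ := fun i => of fun r k => v i (k, r)
  have hK : ∀ P, E P = ∑ i, K i * P * (K i)ᴴ := by
    intro P
    conv_lhs => rw [matrix_eq_sum_single P]
    ext r s
    have hs : ∀ k l, E (single k l (P k l)) r s = P k l * ∑ i, v i (k, r) * star (v i (l, s)) := by
      intro k l
      rw [← hentry, ← mul_one (P k l), ← smul_eq_mul, ← smul_single, map_smul]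
      simp
    simp only [map_sum, Matrix.sum_apply, hs, mul_apply, K, of_apply, conjTranspose_apply,
      Finset.mul_sum, Finset.sum_mul]
    rw [Finset.sum_comm]
    refine (Finset.sum_congr rfl fun l _ => Finset.sum_comm).trans (Finset.sum_comm.trans ?_)
    exact Finset.sum_congr rfl fun i _ => Finset.sum_congr rfl fun l _ =>
      Finset.sum_congr rfl fun k _ => by ring
  refine ⟨m, K, hK, ?_⟩
  ext a b
  have h := hE.2 (single b a 1)
  rw [hK, trace_sum] at h
  simp_rw [fun i => (trace_mul_cycle (K i) (single b a (1 : ℂ)) (K i)ᴴ)] at h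
  rw [← trace_sum, ← Finset.sum_mul] at h
  have h2 : (single b a (1 : ℂ)).trace = (1 : Matrix (Fin n) (Fin n) ℂ) a b := by
    by_cases hab : a = b
    · subst hab; simp
    · rw [one_apply_ne hab, trace_single_eq_of_ne _ _ _ (Ne.symm hab)]
  rw [h2] at h
  rw [← h, trace_mul_single]
  simp

-- With `τ = B * Bᴴ`, multiplying the hypothesis by `Qᴴ` exhibits a vanishing sum of positive
-- matrices `(Q K B)(Q K B)ᴴ`, so each of them has trace zero.
open scoped MatrixOrder Matrix.Norms.L2Operator in
theorem mul_eq_zero_of_sum_mul_mul_conjTranspose {ι m d : Type*} [Fintype ι] [Fintype m]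
    [Fintype d] [DecidableEq m] {K : ι → Matrix d m ℂ} {τ : Matrix m m ℂ} (hτ : τ.PosSemidef)
    {Q : Matrix d d ℂ} (h : Q * ∑ i, K i * τ * (K i)ᴴ = 0) (i : ι) : Q * (K i * τ) = 0 := by
  obtain ⟨B, rfl⟩ : ∃ B : Matrix m m ℂ, τ = B * Bᴴ := by
    obtain ⟨B, hB⟩ := CStarAlgebra.nonneg_iff_eq_star_mul_self.mp hτ.nonneg
    exact ⟨Bᴴ, by rw [conjTranspose_conjTranspose, hB, star_eq_conjTranspose]⟩
  have h0 : ∑ j, (Q * K j * B) * (Q * K j * B)ᴴ = 0 := by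
    have h1 : (Q * ∑ i, K i * (B * Bᴴ) * (K i)ᴴ) * Qᴴ = 0 := by rw [h, zero_mul]
    rw [← h1, Finset.mul_sum, Finset.sum_mul]
    simp only [conjTranspose_mul, Matrix.mul_assoc]
  have h2 : ∀ j, ((Q * K j * B) * (Q * K j * B)ᴴ).trace = 0 := by
    have h3 := congrArg trace h0
    rw [trace_sum, trace_zero, Finset.sum_eq_zero_iff_of_nonneg
      fun j _ => (posSemidef_self_mul_conjTranspose _).trace_nonneg] at h3
    exact fun j => h3 j (Finset.mem_univ j)
  have h4 := trace_mul_conjTranspose_self_eq_zero_iff.1 (h2 i)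
  rw [← Matrix.mul_assoc, ← Matrix.mul_assoc, h4, Matrix.zero_mul]

/-- A Kraus operator of a map that sends `τ` to a multiple of an eigenprojection of `S` maps `τ`
into the corresponding eigenspace. -/
theorem kraus_mul_eq_of_eigenprojection {ι m d : Type*} [Fintype ι] [Fintype m]
    [Fintype d] [DecidableEq d] [DecidableEq m]
    {K : ι → Matrix d m ℂ} {τ : Matrix m m ℂ} (hτ : τ.PosSemidef)
    {S : Matrix d d ℂ} (hS : S * S = 1) {c s : ℂ} (hs : s * s = 1)
    (h : ∑ i, K i * τ * (K i)ᴴ = c • (1 + s • S)) (i : ι) : K i * τ = s • (S * (K i * τ)) := by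
  -- `1 - s • S` annihilates `1 + s • S` because `S` and `s` square to one.
  have h1 : (1 - s • S) * ∑ i, K i * τ * (K i)ᴴ = 0 := by
    rw [h, Matrix.mul_smul, mul_add, sub_mul, sub_mul, smul_mul_smul_comm, hS, hs]
    simp
  have h2 := mul_eq_zero_of_sum_mul_mul_conjTranspose hτ h1 i
  rwa [Matrix.sub_mul, Matrix.one_mul, Matrix.smul_mul, sub_eq_zero] at h2

/-- Kraus operators intertwining `D` with `S` and `D'` with `S'` on the range of `T` compute the
product `D D'`. -/
theorem conjTranspose_mul_eq_of_intertwining {ι m d : Type*} [Fintype ι] [Fintype m]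
    [Fintype d] [DecidableEq m] {K : ι → Matrix d m ℂ} (hK : ∑ i, (K i)ᴴ * K i = 1)
    {T D D' : Matrix m m ℂ} {S S' : Matrix d d ℂ}
    (hD : ∀ i, K i * D = S * (K i * T)) (hD' : ∀ i, K i * D' = S' * (K i * T)) :
    Dᴴ * D' = Tᴴ * (∑ i, (K i)ᴴ * (Sᴴ * S') * K i) * T := by
  calc Dᴴ * D' = Dᴴ * (∑ i, (K i)ᴴ * K i) * D' := by rw [hK, Matrix.mul_one]
    _ = ∑ i, (K i * D)ᴴ * (K i * D') := by
      simp only [Finset.mul_sum, Finset.sum_mul, conjTranspose_mul, Matrix.mul_assoc]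
    _ = _ := by
      simp only [hD, hD', Finset.mul_sum, Finset.sum_mul, conjTranspose_mul, Matrix.mul_assoc]

end Kraus

/-! ### Pauli matrix identities -/

section Pauli

theorem pauli_isHermitian (x : Fin 3) : (pauli x)ᴴ = pauli x := by
  fin_cases x <;> ext i j <;> fin_cases i <;> fin_cases j <;> simp [pauli]

theorem pauli_mul_self (x : Fin 3) : pauli x * pauli x = 1 := by
  fin_cases x <;> ext i j <;> fin_cases i <;> fin_cases j <;> simp [pauli]

theorem pauli_zero_mul_two : pauli 0 * pauli 2 = (-Complex.I) • pauli 1 := by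
  ext i j; fin_cases i <;> fin_cases j <;> simp [pauli]

theorem pauli_trace (x : Fin 3) : (pauli x).trace = 0 := by
  fin_cases x <;> simp [pauli, trace_fin_two]

end Pauli

/-! ### The assemblage and its Bell correlations -/

section Example

/-- The sign `(-1)^{δ_{x,2} δ_{y,1}}`. -/
def flipSign (x : Fin 3) (y : Fin 2) : ℂ := (-1) ^ (deltaY x * (if y = 1 then 1 else 0))

theorem neg_one_pow_mul_self (k : ℕ) : ((-1 : ℂ) ^ k) * (-1) ^ k = 1 := by
  rw [← mul_pow]; simp

theorem exampleAssemblage_zero (x : Fin 3) (y : Fin 2) :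
    exampleAssemblage 0 x y = (1 / 4 : ℂ) • (1 + flipSign x y • pauli x) := by
  simp [exampleAssemblage, flipSign]

theorem exampleAssemblage_one (x : Fin 3) (y : Fin 2) :
    exampleAssemblage 1 x y = (1 / 4 : ℂ) • (1 + (-flipSign x y) • pauli x) := by
  simp only [exampleAssemblage, flipSign, pow_add, Fin.val_one, pow_one, neg_one_mul]

theorem sum_exampleAssemblage (x : Fin 3) (y : Fin 2) :
    ∑ a, exampleAssemblage a x y = (1 / 2 : ℂ) • 1 := by
  rw [Fin.sum_univ_two, exampleAssemblage_zero, exampleAssemblage_one]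
  module

/-- `1 ± σ_x` is positive, being half of its square. -/
theorem posSemidef_one_add_smul_pauli (x : Fin 3) (k : ℕ) :
    (1 + (-1 : ℂ) ^ k • pauli x).PosSemidef := by
  have hh : (1 + (-1 : ℂ) ^ k • pauli x)ᴴ = 1 + (-1 : ℂ) ^ k • pauli x := by
    simp [conjTranspose_smul, pauli_isHermitian]
  have h : 1 + (-1 : ℂ) ^ k • pauli x = (1 / 2 : ℂ) •
      ((1 + (-1 : ℂ) ^ k • pauli x)ᴴ * (1 + (-1 : ℂ) ^ k • pauli x)) := by
    rw [hh, mul_add, add_mul, add_mul, smul_mul_smul_comm, pauli_mul_self, neg_one_pow_mul_self]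
    simp only [mul_one, one_mul]
    module
  rw [h]
  exact (posSemidef_conjTranspose_mul_self _).smul (by norm_num [Complex.le_def])

theorem isNonSignalling_exampleAssemblage : IsNonSignalling exampleAssemblage := by
  refine ⟨fun a x y => ?_, fun x x' y => ?_, ⟨fun _ _ => 1 / 2, fun a x y => ?_⟩, fun x y => ?_⟩
  · exact (posSemidef_one_add_smul_pauli x _).smul (by norm_num [Complex.le_def])
  · rw [sum_exampleAssemblage, sum_exampleAssemblage]
  · simp only [exampleAssemblage, trace_smul, trace_add, pauli_trace, trace_one]
    norm_num
  · rw [sum_exampleAssemblage, trace_smul, trace_one]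
    norm_num

theorem maxEntangled_apply (i j k l : Fin 2) :
    maxEntangled (i, j) (k, l) = if i = j ∧ k = l then 1 / 2 else 0 := by
  have h : ((√2 : ℝ) : ℂ)⁻¹ * ((√2 : ℝ) : ℂ)⁻¹ = 1 / 2 := by
    rw [← mul_inv, ← Complex.ofReal_mul, Real.mul_self_sqrt (by norm_num)]
    norm_num
  by_cases hij : i = j <;> by_cases hkl : k = l <;>
    simp only [maxEntangled, vecMulVec_apply, phiPlus, Pi.star_apply, hij, hkl] <;> simp
  simpa using h

theorem isDensityMatrix_maxEntangled : IsDensityMatrix maxEntangled := by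
  refine ⟨posSemidef_vecMulVec_self_star _, ?_⟩
  simp only [trace, diag_apply, Fintype.sum_prod_type, maxEntangled_apply, Fin.sum_univ_two]
  norm_num

/-- This transpose changes the sign of `Y` alone, which is why `pauliMeasurement` interchanges the
outcomes of `Y`. -/
theorem traceFst_maxEntangled (P : Matrix (Fin 2) (Fin 2) ℂ) :
    traceFst ((P ⊗ₖ (1 : Matrix (Fin 2) (Fin 2) ℂ)) * maxEntangled) = (1 / 2 : ℂ) • Pᵀ := by
  ext i j
  simp only [traceFst, of_apply, mul_apply, Fintype.sum_prod_type, maxEntangled_apply,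
    kroneckerMap_apply, Fin.sum_univ_two, Matrix.smul_apply, transpose_apply, smul_eq_mul,
    one_apply]
  fin_cases i <;> fin_cases j <;> simp <;> ring

theorem trace_mul_traceFst {c d : Type*} [Fintype c] [Fintype d] [DecidableEq c] [DecidableEq d]
    (P : Matrix c c ℂ) (N : Matrix d d ℂ) (ρ : Matrix (c × d) (c × d) ℂ) :
    (N * traceFst ((P ⊗ₖ (1 : Matrix d d ℂ)) * ρ)).trace = ((P ⊗ₖ N) * ρ).trace := by
  have h : P ⊗ₖ N = ((1 : Matrix c c ℂ) ⊗ₖ N) * (P ⊗ₖ (1 : Matrix d d ℂ)) := by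
    rw [← mul_kronecker_mul]; simp
  rw [h, Matrix.mul_assoc]
  generalize (P ⊗ₖ (1 : Matrix d d ℂ)) * ρ = R
  have h2 : ∀ k i, (((1 : Matrix c c ℂ) ⊗ₖ N) * R) (k, i) (k, i) =
      ∑ j, N i j * R (k, j) (k, i) := by
    intro k i
    simp only [mul_apply, Fintype.sum_prod_type_right, kroneckerMap_apply, one_apply, ite_mul,
      one_mul, zero_mul, Finset.sum_ite_eq, Finset.mem_univ, if_true]
  simp only [trace, diag_apply, Fintype.sum_prod_type_right, h2]
  simp only [mul_apply, traceFst, of_apply, Finset.mul_sum]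
  exact Finset.sum_congr rfl fun i _ => Finset.sum_comm

theorem exampleAssemblage_eq_bobMap (a : Fin 2) (x : Fin 3) (y : Fin 2) :
    exampleAssemblage a x y = bobMap y (traceFst
      ((pauliMeasurement a x ⊗ₖ (1 : Matrix (Fin 2) (Fin 2) ℂ)) * maxEntangled)) := by
  rw [traceFst_maxEntangled]
  fin_cases a <;> fin_cases x <;> fin_cases y <;> ext i j <;> fin_cases i <;> fin_cases j <;>
    simp [exampleAssemblage, bobMap, pauliMeasurement, pauli, deltaY] <;> ring

theorem isPOVM_pauliMeasurement (x : Fin 3) : IsPOVM fun a => pauliMeasurement a x := by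
  refine ⟨fun a => (posSemidef_one_add_smul_pauli x _).smul (by norm_num [Complex.le_def]), ?_⟩
  simp only [Fin.sum_univ_two, pauliMeasurement, Fin.val_zero, Fin.val_one, pow_add,
    pow_one]
  module

theorem IsPOVM.bobMap {B : Type*} [Fintype B] {N : B → Matrix (Fin 2) (Fin 2) ℂ} (hN : IsPOVM N)
    (y : Fin 2) : IsPOVM fun b => bobMap y (N b) := by
  by_cases hy : y = 0
  · simpa [Steering.bobMap, hy] using hN
  · simp only [Steering.bobMap, hy, if_false]
    exact ⟨fun b => (hN.1 b).transpose, by rw [← transpose_sum, hN.2, transpose_one]⟩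

/-- The transpose is its own adjoint for the trace pairing. -/
theorem trace_mul_bobMap (y : Fin 2) (P Q : Matrix (Fin 2) (Fin 2) ℂ) :
    (P * bobMap y Q).trace = (bobMap y P * Q).trace := by
  by_cases hy : y = 0
  · simp [bobMap, hy]
  · simp only [bobMap, hy, if_false]
    rw [← trace_transpose, transpose_mul, transpose_transpose, trace_mul_comm]

theorem trace_mul_exampleAssemblage (N : Matrix (Fin 2) (Fin 2) ℂ) (a : Fin 2) (x : Fin 3)
    (y : Fin 2) : (N * exampleAssemblage a x y).trace =
      ((pauliMeasurement a x ⊗ₖ bobMap y N) * maxEntangled).trace := by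
  rw [exampleAssemblage_eq_bobMap, trace_mul_bobMap, trace_mul_traceFst]

/-- Measuring the assemblage gives quantum Bell correlations: Bob's transposition can be moved to
his measurement. -/
theorem isQuantumBell_exampleAssemblage {B W : Type*} [Fintype B]
    (N : B → W → Matrix (Fin 2) (Fin 2) ℂ) (hN : ∀ w, IsPOVM fun b => N b w) (y : W → Fin 2) :
    IsQuantumBell fun (a : Fin 2) (b : B) (x : Fin 3) (w : W) =>
      (N b w * exampleAssemblage a x (y w)).trace :=
  ⟨2, 2, pauliMeasurement, fun b w => bobMap (y w) (N b w), maxEntangled, isPOVM_pauliMeasurement,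
    fun w => (hN w).bobMap (y w), isDensityMatrix_maxEntangled,
    fun _ _ _ _ => trace_mul_exampleAssemblage _ _ _ _⟩

/-! ### Absence of a quantum realisation -/

theorem flipSign_mul_self (x : Fin 3) (y : Fin 2) : flipSign x y * flipSign x y = 1 :=
  neg_one_pow_mul_self _

theorem star_flipSign (x : Fin 3) (y : Fin 2) : star (flipSign x y) = flipSign x y := by
  rw [flipSign, star_pow, star_neg, star_one]

/-- If Bob's map `E` sends the states `τ a x` to the assemblage for the input `y`, then the
products of the matrices `D x = τ 0 x - τ 1 x` and `T = τ 0 x + τ 1 x` obey the relations of the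
Pauli matrices, up to the sign of `Y`. -/
theorem pauli_relations_of_cptp {n : ℕ} {τ : Fin 2 → Fin 3 → Matrix (Fin n) (Fin n) ℂ}
    (hτ : ∀ a x, (τ a x).PosSemidef) {T : Matrix (Fin n) (Fin n) ℂ} (hT : ∀ x, ∑ a, τ a x = T)
    {E : Matrix (Fin n) (Fin n) ℂ →ₗ[ℂ] Matrix (Fin 2) (Fin 2) ℂ} (hE : IsCPTP E) (y : Fin 2)
    (h : ∀ a x, exampleAssemblage a x y = E (τ a x)) :
    (τ 0 0 - τ 1 0) * (τ 0 2 - τ 1 2) =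
        (-Complex.I * flipSign 1 y) • (T * (τ 0 1 - τ 1 1)) ∧
      (τ 0 1 - τ 1 1) * (τ 0 1 - τ 1 1) = T * T := by
  obtain ⟨m, K, hK, hK1⟩ := hE.exists_kraus
  -- Outcomes 0 and 1 land in the `+1` and `-1` eigenspaces of the signed Pauli matrix, so it turns
  -- the image of their sum into that of their difference.
  have hD : ∀ x i, K i * (τ 0 x - τ 1 x) = (flipSign x y • pauli x) * (K i * T) := by
    intro x i
    have h0 := kraus_mul_eq_of_eigenprojection (hτ 0 x) (pauli_mul_self x) (flipSign_mul_self x y)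
      ((hK _).symm.trans ((h 0 x).symm.trans (exampleAssemblage_zero x y))) i
    have h1 := kraus_mul_eq_of_eigenprojection (hτ 1 x) (pauli_mul_self x)
      ((neg_mul_neg _ _).trans (flipSign_mul_self x y))
      ((hK _).symm.trans ((h 1 x).symm.trans (exampleAssemblage_one x y))) i
    rw [neg_smul, eq_comm, neg_eq_iff_eq_neg] at h1
    rw [← hT x, Fin.sum_univ_two, Matrix.mul_sub, Matrix.mul_add, Matrix.mul_add,
      Matrix.smul_mul, Matrix.smul_mul, ← h0, h1, sub_eq_add_neg]
  have hDT : ∀ i, K i * T = (1 : Matrix (Fin 2) (Fin 2) ℂ) * (K i * T) := fun i =>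
    (Matrix.one_mul _).symm
  have hDh : ∀ x, (τ 0 x - τ 1 x)ᴴ = τ 0 x - τ 1 x := fun x =>
    ((hτ 0 x).isHermitian.sub (hτ 1 x).isHermitian)
  have hTh : Tᴴ = T := by
    rw [← hT 0]
    exact (posSemidef_sum _ fun a _ => hτ a 0).isHermitian
  have hSh : ∀ x, (flipSign x y • pauli x)ᴴ = flipSign x y • pauli x := fun x => by
    rw [conjTranspose_smul, star_flipSign, pauli_isHermitian]
  have hxz := conjTranspose_mul_eq_of_intertwining hK1 (hD 0) (hD 2)
  have hty := conjTranspose_mul_eq_of_intertwining hK1 hDT (hD 1)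
  have hyy := conjTranspose_mul_eq_of_intertwining hK1 (hD 1) (hD 1)
  have htt := conjTranspose_mul_eq_of_intertwining hK1 hDT hDT
  have hx : flipSign 0 y = 1 := by simp [flipSign, deltaY]
  have hz : flipSign 2 y = 1 := by simp [flipSign, deltaY]
  rw [hSh, smul_mul_smul_comm, flipSign_mul_self, pauli_mul_self, one_smul, hDh, hTh] at hyy
  rw [conjTranspose_one, Matrix.one_mul, hTh] at htt
  rw [conjTranspose_one, Matrix.one_mul, hTh] at hty
  rw [hSh, smul_mul_smul_comm, hx, hz, pauli_zero_mul_two, hDh, hTh, mul_one, one_smul] at hxz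
  refine ⟨?_, hyy.trans htt.symm⟩
  rw [hxz, hty]
  simp only [Matrix.mul_smul, Matrix.smul_mul, ← Finset.smul_sum, smul_smul]
  rw [mul_assoc (-Complex.I), flipSign_mul_self, mul_one]

theorem not_isQuantumRealisable_exampleAssemblage :
    ¬ IsQuantumRealisable.{u} exampleAssemblage := by
  rintro ⟨H, _, _, _, ι, e, n, M, ρ, τ, E, hM, hρ, hτ, hE, h⟩
  have hsum : ∀ x, IsPartialTrace e ρ.toLinearMap (∑ a, τ a x) := fun x =>
    IsPartialTrace.sum_of_povm (hM x).2 fun a => hτ a x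
  have hpos : ∀ a x, (τ a x).PosSemidef := fun a x =>
    IsPartialTrace.posSemidef ((hM x).1 a) hρ.1 (hsum x) (hτ a x)
  obtain ⟨T, hT⟩ : ∃ T, ∀ x, ∑ a, τ a x = T := ⟨_, fun x => (hsum x).unique (hsum 0)⟩
  obtain ⟨h0, hyy⟩ := pauli_relations_of_cptp hpos hT (hE 0) 0 fun a x => h a x 0
  obtain ⟨h1, -⟩ := pauli_relations_of_cptp hpos hT (hE 1) 1 fun a x => h a x 1
  have hTh : Tᴴ = T := by
    rw [← hT 0]
    exact (posSemidef_sum _ fun a _ => hpos a 0).isHermitian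
  -- The two values of `y` express the same product with opposite signs.
  have hTD : T * (τ 0 1 - τ 1 1) = 0 := by
    rw [h0] at h1
    have h2 : (2 * -Complex.I) • (T * (τ 0 1 - τ 1 1)) = 0 := by
      have hs0 : flipSign 1 0 = 1 := by simp [flipSign]
      have hs1 : flipSign 1 1 = -1 := by simp [flipSign, deltaY]
      rw [hs0, hs1, mul_one, mul_neg, mul_one, neg_smul (-Complex.I)] at h1
      rw [two_mul, add_smul]
      exact add_eq_zero_iff_eq_neg.2 h1
    simpa using h2
  have hT0 : T = 0 := by
    -- Replacing one `T * T` by the square of `τ 0 1 - τ 1 1` brings in the vanishing product `hTD`.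
    have h4 : (T * T) * (T * T)ᴴ = 0 := by
      rw [conjTranspose_mul, hTh]
      nth_rewrite 2 [← hyy]
      rw [← Matrix.mul_assoc, Matrix.mul_assoc T T, hTD, Matrix.mul_zero, Matrix.zero_mul]
    have h2 : T * Tᴴ = 0 := by
      rw [hTh]; exact self_mul_conjTranspose_eq_zero.1 h4
    exact self_mul_conjTranspose_eq_zero.1 h2
  have htr : (∑ a, exampleAssemblage a 0 0).trace = 1 := isNonSignalling_exampleAssemblage.2.2.2 0 0
  simp only [h] at htr
  rw [← map_sum, hT, hT0, map_zero, trace_zero] at htr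
  exact zero_ne_one htr

end Example

end Steering

theorem theorem2 :
    -- the assemblage is non-signalling
    Steering.IsNonSignalling Steering.exampleAssemblage ∧
    -- Pauli measurements on a maximally entangled state, then the identity or the transpose
    (∀ a x y, Steering.exampleAssemblage a x y =
      Steering.bobMap y (Steering.traceFst
        ((Steering.pauliMeasurement a x ⊗ₖ (1 : Matrix (Fin 2) (Fin 2) ℂ)) *
          Steering.maxEntangled))) ∧
    -- it has no quantum realisation
    ¬ Steering.IsQuantumRealisable.{u} Steering.exampleAssemblage ∧
    -- every measurement of Bob gives quantum Bell correlations
    (∀ (B : Type v) [Fintype B] (N : B → Matrix (Fin 2) (Fin 2) ℂ), Steering.IsPOVM N →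
      Steering.IsQuantumBell (fun (a : Fin 2) (b : B) (x : Fin 3) (y : Fin 2) =>
        (N b * Steering.exampleAssemblage a x y).trace)) ∧
    -- also if Bob chooses between measurements, labelled by an additional input `z`
    (∀ (B : Type v) [Fintype B] (Z : Type w) (N : B → Z → Matrix (Fin 2) (Fin 2) ℂ),
      (∀ z, Steering.IsPOVM (fun b => N b z)) →
      Steering.IsQuantumBell (fun (a : Fin 2) (b : B) (x : Fin 3) (yz : Fin 2 × Z) =>
        (N b yz.2 * Steering.exampleAssemblage a x yz.1).trace)) := by
  refine ⟨Steering.isNonSignalling_exampleAssemblage, Steering.exampleAssemblage_eq_bobMap,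
    Steering.not_isQuantumRealisable_exampleAssemblage, ?_, ?_⟩
  · intro B _ N hN
    exact Steering.isQuantumBell_exampleAssemblage (fun b (_ : Fin 2) => N b) (fun _ => hN)
      fun y => y
  · intro B _ Z N hN
    exact Steering.isQuantumBell_exampleAssemblage (fun b (yz : Fin 2 × Z) => N b yz.2)
      (fun yz => hN yz.2) fun yz => yz.1
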